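/- Let $(M,g)$ be an $n$-dimensional smooth semi-Riemannian manifold with Levi-Civita connection $\nabla$, let $X$ be a smooth vector field on $M$, let $\mathcal E$ be the set of zeros of $X$, and let $f=\tfrac12 g(X,X)$. Let $F$ be the $(1,1)$-tensor field with components $$F_j{}^i=\nabla_jX^i-g^{ih}g_{kj}\nabla_hX^k ,$$ and consider smooth curves $x(t)$, defined on open intervals, that solve $$\frac{\nabla}{dt}\frac{dx}{dt}=\operatorname{grad} f+F\Big(\frac{dx}{dt}\Big).\qquad (3'')$$ Assume that $f$ takes values in $\{-1,0,1\}$ on $M\setminus\mathcal E$. Let $k>0$ and $w$ be real constants and, for a tangent vector $y$ at a point of $M$, put $$\alpha(y)=|g(y,y)|^{1/2},\qquad \beta(y)=k^{1/2}g(X,y),\qquad L(y)=w\,\alpha(y)\,\beta(y)$$ (so $\alpha^2=g(y,y)$ when $g(y,y)\ge 0$; when $g(y,y)<0$ the constant factor $\sqrt{-1}$ in $g(y,y)^{1/2}$ is dropped from $L$). Then every trajectory $x(t)$ of $(3'')$ contained in $M\setminus\mathcal E$ and satisfying $$g\Big(\frac{dx}{dt},\frac{dx}{dt}\Big)k^{1/2}+\beta\Big(\frac{dx}{dt}\Big)=0$$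 for all $t$ is a pregeodesic of the semi-Finsler-Jacobi structure $(M\setminus\mathcal E,\ L)$: after a smooth change of parameter with nowhere vanishing derivative it is a geodesic of $L$, that is, an extremal of $\int L(dx/dt)\,dt$, meaning that in every chart $L$ is differentiable at the points $(x,dx/dt)$ of the curve and the Euler-Lagrange equation $\frac{d}{dt}\frac{\partial L}{\partial y}=\frac{\partial L}{\partial x}$, $y=dx/dt$, holds along it (including the existence of the derivative with respect to $t$). -/

import Mathlib

open scoped Manifold ContDiff

noncomputable section

/-- A semi-Riemannian metric on an `n`-dimensional smooth manifold: a smooth symmetric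
nondegenerate `(0,2)`-tensor field. -/
structure SemiRiemannMetric (n : ℕ) (M : Type*) [TopologicalSpace M]
    [ChartedSpace (EuclideanSpace ℝ (Fin n)) M] [IsManifold (𝓡 n) ∞ M] where
  /-- The scalar product on each tangent space. -/
  inner (x : M) : TangentSpace (𝓡 n) x →L[ℝ] TangentSpace (𝓡 n) x →L[ℝ] ℝ
  symm (x : M) (v w : TangentSpace (𝓡 n) x) : inner x v w = inner x w v
  nondegenerate (x : M) (v : TangentSpace (𝓡 n) x) (hv : ∀ w, inner x v w = 0) : v = 0
  contMDiff : ContMDiff (𝓡 n)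
    ((𝓡 n).prod 𝓘(ℝ, EuclideanSpace ℝ (Fin n) →L[ℝ] EuclideanSpace ℝ (Fin n) →L[ℝ] ℝ)) ∞
    (fun x ↦ Bundle.TotalSpace.mk'
      (EuclideanSpace ℝ (Fin n) →L[ℝ] EuclideanSpace ℝ (Fin n) →L[ℝ] ℝ)
      (E := fun x : M ↦ TangentSpace (𝓡 n) x →L[ℝ] TangentSpace (𝓡 n) x →L[ℝ] ℝ) x (inner x))

namespace GeomDyn

variable {n : ℕ} {M : Type*} [TopologicalSpace M]
  [ChartedSpace (EuclideanSpace ℝ (Fin n)) M] [IsManifold (𝓡 n) ∞ M]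

/-- The partial derivative `∂h/∂xⁱ` at the point `p`. -/
def partialDeriv (i : Fin n) (h : EuclideanSpace ℝ (Fin n) → ℝ)
    (p : EuclideanSpace ℝ (Fin n)) : ℝ :=
  fderiv ℝ h p (EuclideanSpace.single i 1)

/-- The tangent vector `yⁱ ∂/∂xⁱ` of `M` at the point with coordinates `p` in the chart `e`. -/
def chartVec (e : OpenPartialHomeomorph M (EuclideanSpace ℝ (Fin n)))
    (p y : EuclideanSpace ℝ (Fin n)) : TangentSpace (𝓡 n) (e.symm p) :=
  mfderiv (𝓡 n) (𝓡 n) e.symm p y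

/-- The matrix `(g_{ij})` of the metric in the chart `e`. -/
def metricMatrix (g : SemiRiemannMetric n M)
    (e : OpenPartialHomeomorph M (EuclideanSpace ℝ (Fin n))) (p : EuclideanSpace ℝ (Fin n)) :
    Matrix (Fin n) (Fin n) ℝ :=
  Matrix.of fun i j ↦
    g.inner (e.symm p) (chartVec e p (EuclideanSpace.single i 1))
      (chartVec e p (EuclideanSpace.single j 1))

/-- The Christoffel symbols `Γⁱ_{jk}` of the Levi-Civita connection in the chart `e`. -/
def christoffel (g : SemiRiemannMetric n M)
    (e : OpenPartialHomeomorph M (EuclideanSpace ℝ (Fin n))) (i j k : Fin n)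
    (p : EuclideanSpace ℝ (Fin n)) : ℝ :=
  (1 / 2) * ∑ h, (metricMatrix g e p)⁻¹ i h *
    (partialDeriv j (fun q ↦ metricMatrix g e q h k) p
      + partialDeriv k (fun q ↦ metricMatrix g e q h j) p
      - partialDeriv h (fun q ↦ metricMatrix g e q j k) p)

/-- The vector field `X` written in the coordinates of the chart `e`. -/
def fieldRep (X : (x : M) → TangentSpace (𝓡 n) x)
    (e : OpenPartialHomeomorph M (EuclideanSpace ℝ (Fin n))) (p : EuclideanSpace ℝ (Fin n)) :
    EuclideanSpace ℝ (Fin n) :=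
  mfderiv (𝓡 n) (𝓡 n) e (e.symm p) (X (e.symm p))

/-- The component `Xⁱ` of the vector field `X` in the chart `e`. -/
def fieldComp (X : (x : M) → TangentSpace (𝓡 n) x)
    (e : OpenPartialHomeomorph M (EuclideanSpace ℝ (Fin n))) (i : Fin n)
    (p : EuclideanSpace ℝ (Fin n)) : ℝ :=
  fieldRep X e p i

/-- The component `∇_j Xⁱ` of the covariant derivative of `X` in the chart `e`. -/
def covDeriv (g : SemiRiemannMetric n M) (X : (x : M) → TangentSpace (𝓡 n) x)
    (e : OpenPartialHomeomorph M (EuclideanSpace ℝ (Fin n))) (j i : Fin n)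
    (p : EuclideanSpace ℝ (Fin n)) : ℝ :=
  partialDeriv j (fieldComp X e i) p + ∑ k, christoffel g e i j k p * fieldComp X e k p

/-- The component `F_jⁱ = ∇_j Xⁱ - g^{ih} g_{kj} ∇_h Xᵏ` of the helicity tensor in the
chart `e`. -/
def helicity (g : SemiRiemannMetric n M) (X : (x : M) → TangentSpace (𝓡 n) x)
    (e : OpenPartialHomeomorph M (EuclideanSpace ℝ (Fin n))) (j i : Fin n)
    (p : EuclideanSpace ℝ (Fin n)) : ℝ :=
  covDeriv g X e j i p
    - ∑ h, ∑ k, (metricMatrix g e p)⁻¹ i h * metricMatrix g e p k j * covDeriv g X e h k p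

/-- The energy `f = g(X, X) / 2` of the vector field `X`. -/
def energy (g : SemiRiemannMetric n M) (X : (x : M) → TangentSpace (𝓡 n) x) (x : M) : ℝ :=
  (1 / 2) * g.inner x (X x) (X x)

/-- The component `(grad f)ⁱ = g^{ih} ∂f/∂xʰ` of the gradient of `f` in the chart `e`. -/
def gradComp (g : SemiRiemannMetric n M) (f : M → ℝ)
    (e : OpenPartialHomeomorph M (EuclideanSpace ℝ (Fin n))) (i : Fin n)
    (p : EuclideanSpace ℝ (Fin n)) : ℝ :=
  ∑ h, (metricMatrix g e p)⁻¹ i h * partialDeriv h (fun q ↦ f (e.symm q)) p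

/-- The expression of the curve `γ` in the chart `e`. -/
def chartCurve (e : OpenPartialHomeomorph M (EuclideanSpace ℝ (Fin n))) (γ : ℝ → M) (t : ℝ) :
    EuclideanSpace ℝ (Fin n) :=
  e (γ t)

/-- The component `d²xⁱ/dt² + Γⁱ_{jk} (dxʲ/dt) (dxᵏ/dt)` of the covariant acceleration
`(∇/dt)(dx/dt)` in the chart `e`. -/
def covAccel (g : SemiRiemannMetric n M)
    (e : OpenPartialHomeomorph M (EuclideanSpace ℝ (Fin n))) (γ : ℝ → M) (i : Fin n)
    (t : ℝ) : ℝ :=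
  deriv (deriv (chartCurve e γ)) t i
    + ∑ j, ∑ k, christoffel g e i j k (chartCurve e γ t)
        * deriv (chartCurve e γ) t j * deriv (chartCurve e γ) t k

/-- The velocity vector `dx/dt` of a curve in `M`. -/
def velocity (γ : ℝ → M) (t : ℝ) : TangentSpace (𝓡 n) (γ t) :=
  mfderiv 𝓘(ℝ, ℝ) (𝓡 n) γ t (1 : ℝ)

/-- The smooth curve `γ`, defined on the open interval `I`, is a trajectory of the geometric
dynamics `(∇/dt)(dx/dt) = grad f + F(dx/dt)` with `f = g(X, X) / 2`. -/
structure IsTrajectory (g : SemiRiemannMetric n M) (X : (x : M) → TangentSpace (𝓡 n) x)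
    (γ : ℝ → M) (I : Set ℝ) : Prop where
  isOpen : IsOpen I
  ordConnected : I.OrdConnected
  smooth : ContMDiffOn 𝓘(ℝ, ℝ) (𝓡 n) ∞ γ I
  equation : ∀ e ∈ IsManifold.maximalAtlas (𝓡 n) ∞ M, ∀ t ∈ I, γ t ∈ e.source → ∀ i : Fin n,
    covAccel g e γ i t = gradComp g (energy g X) e i (chartCurve e γ t)
      + ∑ j, helicity g X e j i (chartCurve e γ t) * deriv (chartCurve e γ) t j

/-- The set of zeros of `X`. -/
def equilibria (X : (x : M) → TangentSpace (𝓡 n) x) : Set M := {x | X x = 0}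

/-- The function `α(y) = |g(y, y)|^{1/2}` on the tangent bundle, so that `α² = g(y, y)` where
`g(y, y) ≥ 0`. Where `g(y, y) < 0` the square root of `g(y, y)` is `α` up to the constant factor
`√-1`, which does not affect the extremals of `w α β`. -/
def alpha (g : SemiRiemannMetric n M) (x : M) (y : TangentSpace (𝓡 n) x) : ℝ :=
  √|g.inner x y y|

/-- The function `β(y) = k^{1/2} g(X, y)` on the tangent bundle. -/
def beta (g : SemiRiemannMetric n M) (X : (x : M) → TangentSpace (𝓡 n) x) (k : ℝ)
    (x : M) (y : TangentSpace (𝓡 n) x) : ℝ :=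
  √k * g.inner x (X x) y

/-- The function `L = w α β` on the tangent bundle. -/
def finslerJacobi (g : SemiRiemannMetric n M) (X : (x : M) → TangentSpace (𝓡 n) x) (k w : ℝ)
    (x : M) (y : TangentSpace (𝓡 n) x) : ℝ :=
  w * alpha g x y * beta g X k x y

/-- The function `L` on the tangent bundle, written in the coordinates `(x, y)` that the
chart `e` induces. -/
def chartLagrangian (L : (x : M) → TangentSpace (𝓡 n) x → ℝ)
    (e : OpenPartialHomeomorph M (EuclideanSpace ℝ (Fin n))) (p y : EuclideanSpace ℝ (Fin n)) :
    ℝ :=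
  L (e.symm p) (chartVec e p y)

/-- The smooth curve `γ`, defined on the open interval `J` and contained in `U`, is a geodesic
of the structure `(U, L = F²)`: it is an extremal of the energy `∫ L(x, dx/dt) dt`, i.e. in every
chart the Euler-Lagrange equation `d/dt (∂L/∂y) = ∂L/∂x` with `y = dx/dt` holds (it is part of the
definition that the derivatives in it exist). -/
structure IsGeodesic (U : Set M) (L : (x : M) → TangentSpace (𝓡 n) x → ℝ)
    (γ : ℝ → M) (J : Set ℝ) : Prop where
  isOpen : IsOpen J
  ordConnected : J.OrdConnected
  mem : ∀ t ∈ J, γ t ∈ U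
  smooth : ContMDiffOn 𝓘(ℝ, ℝ) (𝓡 n) ∞ γ J
  differentiableAt : ∀ e ∈ IsManifold.maximalAtlas (𝓡 n) ∞ M, ∀ t ∈ J, γ t ∈ e.source →
    DifferentiableAt ℝ
      (fun z : EuclideanSpace ℝ (Fin n) × EuclideanSpace ℝ (Fin n) ↦
        chartLagrangian L e z.1 z.2)
      (chartCurve e γ t, deriv (chartCurve e γ) t)
  eulerLagrange : ∀ e ∈ IsManifold.maximalAtlas (𝓡 n) ∞ M, ∀ t ∈ J, γ t ∈ e.source →
    HasDerivAt
      (fun s ↦ fderiv ℝ (fun y ↦ chartLagrangian L e (chartCurve e γ s) y)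
        (deriv (chartCurve e γ) s))
      (fderiv ℝ (fun p ↦ chartLagrangian L e p (deriv (chartCurve e γ) t)) (chartCurve e γ t))
      t

/-- The smooth curve `γ`, defined on the open interval `I`, is a pregeodesic of `(U, L = F²)`:
it becomes a geodesic after a reparametrization, i.e. a change of parameter by a diffeomorphism
`φ` of an open interval `J` onto `I`. -/
def IsPregeodesic (U : Set M) (L : (x : M) → TangentSpace (𝓡 n) x → ℝ)
    (γ : ℝ → M) (I : Set ℝ) : Prop :=
  ContMDiffOn 𝓘(ℝ, ℝ) (𝓡 n) ∞ γ I ∧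
    ∃ (J : Set ℝ) (φ : ℝ → ℝ), IsOpen J ∧ J.OrdConnected ∧ ContDiffOn ℝ ∞ φ J ∧
      (∀ s ∈ J, deriv φ s ≠ 0) ∧ φ '' J = I ∧ IsGeodesic U L (γ ∘ φ) J

end GeomDyn

end

/-! Write `G = g(y,y)` and `b = g(X,y)`, so that `L = K √|G| b` with `K = w √k`. The hypothesis on
the curve says `b = -G`, and wherever this holds `dL = K √|G| d(b - G/2)`; at null vectors both
sides vanish (`hasFDerivAt_sqrt_abs_mul`). Off the zeros of `X` the energy `f` is continuous with
values in a discrete set, hence locally constant, and `grad f` drops out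
(`gradComp_energy_eq_zero`). With its index lowered, the remaining equation `∇y/dt = F(y)` is the
Euler-Lagrange equation of `b - G/2`, because the lowered `F` is the exterior derivative of the
one-form `g(X,·)` (`lowered_equation`). Since that form is skew, `G` is constant along the curve.
The factor `K √|G|` is then constant too, and the Euler-Lagrange equation passes to `L`
(`eulerLagrange_lagrangian`). The trajectory is thus a geodesic in its own parameter. -/

noncomputable section

namespace GeomDyn

/-! ### Calculus of the Lagrangian `K √|B y y| W y` on a normed space. -/

section Calculus

variable {E : Type*} [NormedAddCommGroup E] [NormedSpace ℝ E]

/-- Where `b = -G`, the function `√|G| b` has the derivative `√|G| (b' - G' / 2)`, even at the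
zeros of `G`. -/
theorem hasFDerivAt_sqrt_abs_mul {G b : E → ℝ} {G' b' : E →L[ℝ] ℝ} {z : E}
    (hG : HasFDerivAt G G' z) (hb : HasFDerivAt b b' z) (h : b z = -G z) :
    HasFDerivAt (fun u ↦ √|G u| * b u) (√|G z| • (b' - (1 / 2 : ℝ) • G')) z := by
  by_cases h0 : G z = 0
  -- `√|G|` need not be differentiable here, but it tends to `0` while `b` is `O(u - z)`, so the
  -- product is `o(u - z)`.
  · have hbz : b z = 0 := by simp [h, h0]
    have h1 : (fun u ↦ √|G u|) =o[nhds z] (fun _ ↦ (1 : ℝ)) := by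
      rw [Asymptotics.isLittleO_one_iff]
      have : ContinuousAt (fun u ↦ √|G u|) z := hG.continuousAt.abs.sqrt
      simpa [ContinuousAt, h0] using this
    have h2 : b =O[nhds z] (fun u ↦ u - z) := by
      simpa [hbz] using hb.isBigO_sub
    rw [hasFDerivAt_iff_isLittleO]
    simpa [h0, hbz] using (h1.mul_isBigO h2.norm_right).norm_right
  · have habs : HasFDerivAt (fun u ↦ |G u|) ((SignType.sign (G z) : ℝ) • G') z :=
      (hasDerivAt_abs h0).comp_hasFDerivAt z hG
    have h1 := (habs.sqrt (abs_ne_zero.2 h0)).mul hb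
    refine h1.congr_fderiv ?_
    have hs : √|G z| ≠ 0 := (Real.sqrt_pos.2 (abs_pos.2 h0)).ne'
    have hss : √|G z| * √|G z| = |G z| := Real.mul_self_sqrt (abs_nonneg _)
    have hsg : (SignType.sign (G z) : ℝ) * G z = |G z| := sign_mul_self _
    ext v
    simp only [add_apply, smul_apply,
      sub_apply, smul_eq_mul, h]
    field_simp
    -- The hypothesis `b = -G` turns `sign(G) b` into `-|G| = -√|G|²`, which cancels the root in the
    -- denominator.
    linear_combination G' v * hss - G' v * hsg

theorem hasFDerivAt_const_mul_sqrt_abs_mul {G b : E → ℝ} {G' b' : E →L[ℝ] ℝ} {z : E} (K : ℝ)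
    (hG : HasFDerivAt G G' z) (hb : HasFDerivAt b b' z) (h : b z = -G z) :
    HasFDerivAt (fun u ↦ K * (√|G u| * b u))
      ((K * √|G z|) • (b' - (1 / 2 : ℝ) • G')) z := by
  rw [mul_smul]
  exact (hasFDerivAt_sqrt_abs_mul hG hb h).const_mul K

variable {B : E → E →L[ℝ] E →L[ℝ] ℝ} {W : E → E →L[ℝ] ℝ}

/-- This is the momentum `∂L/∂y`; symmetry of `A` gives `G' = 2 A y`, which absorbs the factor
`1/2`. -/
theorem hasFDerivAt_lagrangian_fiber (K : ℝ) (A : E →L[ℝ] E →L[ℝ] ℝ) (η : E →L[ℝ] ℝ)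
    (hA : ∀ u v, A u v = A v u) (y : E) (h : η y = -A y y) :
    HasFDerivAt (fun v ↦ K * (√|A v v| * η v)) ((K * √|A y y|) • (η - A y)) y := by
  have hG : HasFDerivAt (fun v ↦ A v v) ((2 : ℝ) • A y) y := by
    refine (A.hasFDerivAt.clm_apply (hasFDerivAt_id y)).congr_fderiv ?_
    ext v
    simp [hA v y, two_mul]
  refine (hasFDerivAt_const_mul_sqrt_abs_mul K hG η.hasFDerivAt h).congr_fderiv ?_
  ext v
  simp

theorem hasFDerivAt_lagrangian_base (K : ℝ) {x y : E} {B' : E →L[ℝ] E →L[ℝ] E →L[ℝ] ℝ}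
    {W' : E →L[ℝ] E →L[ℝ] ℝ} (hB : HasFDerivAt B B' x) (hW : HasFDerivAt W W' x)
    (h : W x y = -B x y y) :
    HasFDerivAt (fun p ↦ K * (√|B p y y| * W p y))
      ((K * √|B x y y|) • (W'.flip y - (1 / 2 : ℝ) • (B'.flip y).flip y)) x := by
  have hG : HasFDerivAt (fun p ↦ B p y y) ((B'.flip y).flip y) x := by
    refine ((hB.clm_apply (hasFDerivAt_const y x)).clm_apply
      (hasFDerivAt_const y x)).congr_fderiv ?_
    ext v
    simp
  have hb : HasFDerivAt (fun p ↦ W p y) (W'.flip y) x := by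
    refine (hW.clm_apply (hasFDerivAt_const y x)).congr_fderiv ?_
    ext v
    simp
  exact hasFDerivAt_const_mul_sqrt_abs_mul K hG hb h

theorem differentiableAt_lagrangian (K : ℝ) {x y : E} (hB : DifferentiableAt ℝ B x)
    (hW : DifferentiableAt ℝ W x) (h : W x y = -B x y y) :
    DifferentiableAt ℝ (fun z : E × E ↦ K * (√|B z.1 z.2 z.2| * W z.1 z.2)) (x, y) := by
  have hB' : DifferentiableAt ℝ (fun z : E × E ↦ B z.1) (x, y) :=
    DifferentiableAt.comp (𝕜 := ℝ) (g := B)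
      (f := (Prod.fst : E × E → E)) (F := E) (G := E →L[ℝ] E →L[ℝ] ℝ) (x, y) hB differentiableAt_fst
  have hW' : DifferentiableAt ℝ (fun z : E × E ↦ W z.1) (x, y) :=
    DifferentiableAt.comp (𝕜 := ℝ) (g := W)
      (f := (Prod.fst : E × E → E)) (F := E) (G := E →L[ℝ] ℝ) (x, y) hW differentiableAt_fst
  exact (hasFDerivAt_const_mul_sqrt_abs_mul K
    ((hB'.clm_apply differentiableAt_snd).clm_apply differentiableAt_snd).hasFDerivAt
    (hW'.clm_apply differentiableAt_snd).hasFDerivAt h).differentiableAt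

/-- If the curve `x` solves the Euler-Lagrange equation of `W y - B y y / 2` and
`W y = -B y y` along it, then it solves the Euler-Lagrange equation of `K √|B y y| W y`. -/
theorem eulerLagrange_lagrangian (K : ℝ) {x y a : ℝ → E} {S : Set ℝ} (hS : IsOpen S)
    (hx : ∀ s ∈ S, HasDerivAt x (y s) s) (hy : ∀ s ∈ S, HasDerivAt y (a s) s)
    {B' : ℝ → E →L[ℝ] E →L[ℝ] E →L[ℝ] ℝ} {W' : ℝ → E →L[ℝ] E →L[ℝ] ℝ}
    (hB : ∀ s ∈ S, HasFDerivAt B (B' s) (x s)) (hW : ∀ s ∈ S, HasFDerivAt W (W' s) (x s))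
    (hsymm : ∀ s ∈ S, ∀ u v, B (x s) u v = B (x s) v u)
    (heq : ∀ s ∈ S, ∀ v, B (x s) (a s) v + B' s (y s) (y s) v - 1 / 2 * B' s v (y s) (y s)
      = W' s (y s) v - W' s v (y s))
    (h : ∀ s ∈ S, W (x s) (y s) = -B (x s) (y s) (y s)) {t : ℝ} (ht : t ∈ S) :
    HasDerivAt
      (fun s ↦ fderiv ℝ (fun v ↦ K * (√|B (x s) v v| * W (x s) v)) (y s))
      (fderiv ℝ (fun p ↦ K * (√|B p (y t) (y t)| * W p (y t))) (x t)) t := by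
  have hBx : ∀ s ∈ S, HasDerivAt (fun s ↦ B (x s) (y s)) (B' s (y s) (y s) + B (x s) (a s)) s := by
    intro s hs
    have h1 : HasDerivAt (fun s ↦ B (x s)) (B' s (y s)) s :=
      HasFDerivAt.comp_hasDerivAt (E := E →L[ℝ] E →L[ℝ] ℝ) (l := B) s (hB s hs) (hx s hs)
    exact h1.clm_apply (hy s hs)
  -- Conservation of `g(y,y)`: for `v = y` the right side of `heq` vanishes by skewness, and the
  -- left side is half of this derivative.
  have hG : ∀ s ∈ S, HasDerivAt (fun s ↦ B (x s) (y s) (y s)) 0 s := by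
    intro s hs
    refine ((hBx s hs).clm_apply (hy s hs)).congr_deriv ?_
    have h1 := heq s hs (y s)
    simp only [add_apply, hsymm s hs (y s) (a s)]
    linarith
  -- `S` may be disconnected, so constancy is taken on a ball around `t`, which is enough for a
  -- derivative at `t`.
  obtain ⟨ε, hε, hball⟩ := Metric.isOpen_iff.1 hS t ht
  have hconst : ∀ s ∈ Metric.ball t ε,
      B (x s) (y s) (y s) = B (x t) (y t) (y t) := by
    intro s hs
    refine Metric.isOpen_ball.is_const_of_deriv_eq_zero (𝕜 := ℝ)
      (f := fun s ↦ B (x s) (y s) (y s))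
      (convex_ball t ε).isPreconnected (fun r hr ↦ ?_) (fun r hr ↦ ?_) hs
      (Metric.mem_ball_self hε)
    · exact (hG r (hball hr)).differentiableAt.differentiableWithinAt
    · exact (hG r (hball hr)).deriv
  have hWx : HasDerivAt (fun s ↦ W (x s)) (W' t (y t)) t := 
    HasFDerivAt.comp_hasDerivAt (E := E →L[ℝ] ℝ) (l := W) t (hW t ht) (hx t ht)
  have hd := (hWx.sub (hBx t ht)).const_smul (K * √|B (x t) (y t) (y t)|)
  rw [(hasFDerivAt_lagrangian_base K (hB t ht) (hW t ht) (h t ht)).fderiv]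
  refine (hd.congr_of_eventuallyEq ?_).congr_deriv ?_
  · filter_upwards [Metric.ball_mem_nhds t hε] with s hs
    rw [(hasFDerivAt_lagrangian_fiber K (B (x s)) (W (x s)) (hsymm s (hball hs)) (y s)
      (h s (hball hs))).fderiv, hconst s hs]
    rfl
  · congr 1
    ext v
    have h1 := heq t ht v
    simp only [add_apply, sub_apply,
      smul_apply, ContinuousLinearMap.flip_apply, smul_eq_mul]
    linarith

end Calculus

/-! ### Index computation: lowering the trajectory equation. -/

section Tensor

variable {ι : Type*} [Fintype ι] [DecidableEq ι]

theorem sum_mul_sum_inv_mul {m c : Matrix ι ι ℝ} (hc : m * c = 1) (Z : ι → ℝ) (l : ι) :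
    ∑ i, m l i * ∑ h, c i h * Z h = Z l := by
  have : m.mulVec (c.mulVec Z) l = Z l := by simp [hc]
  simpa [Matrix.mulVec, dotProduct] using this

/-- The equation `∇y/dt = F(y)` with the index lowered. -/
theorem lowered_equation {m c : Matrix ι ι ℝ} (hc : m * c = 1) (hm : ∀ i j, m i j = m j i)
    {dm : ι → ι → ι → ℝ} (hdm : ∀ h i j, dm h i j = dm h j i)
    {Γ : ι → ι → ι → ℝ}
    (hΓ : ∀ i j k, Γ i j k = 1 / 2 * ∑ h, c i h * (dm j h k + dm k h j - dm h j k))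
    {X : ι → ℝ} {dX D F : ι → ι → ℝ} (hD : ∀ j i, D j i = dX j i + ∑ k, Γ i j k * X k)
    (hF : ∀ j i, F j i = D j i - ∑ h, ∑ k, c i h * m k j * D h k)
    {y a : ι → ℝ} (heq : ∀ i, a i + ∑ j, ∑ k, Γ i j k * y j * y k = ∑ j, F j i * y j) (l : ι) :
    ∑ i, m l i * a i + ∑ j, ∑ k, dm j k l * y j * y k - 1 / 2 * ∑ j, ∑ k, dm l j k * y j * y k
      = ∑ j, ((∑ k, (dm j k l * X k + m k l * dX j k))
          - ∑ k, (dm l k j * X k + m k j * dX l k)) * y j := by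
  -- Christoffel symbols of the first kind.
  have hΓm : ∀ l j k, ∑ i, m l i * Γ i j k = 1 / 2 * (dm j l k + dm k l j - dm l j k) := by
    intro l j k
    rw [← sum_mul_sum_inv_mul hc (fun h ↦ dm j h k + dm k h j - dm h j k) l, Finset.mul_sum]
    exact Finset.sum_congr rfl fun i _ ↦ by rw [hΓ]; ring
  have hDm : ∀ l j, ∑ i, m l i * D j i
      = ∑ k, (m l k * dX j k + 1 / 2 * (dm j l k + dm k l j - dm l j k) * X k) := by
    intro l j
    simp only [hD, mul_add, Finset.sum_add_distrib, Finset.mul_sum]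
    congr 1
    rw [Finset.sum_comm]
    refine Finset.sum_congr rfl fun k _ ↦ ?_
    rw [← hΓm, Finset.sum_mul]
    exact Finset.sum_congr rfl fun i _ ↦ by ring
  have hFm : ∀ j, ∑ i, m l i * F j i = ∑ i, m l i * D j i - ∑ i, m j i * D l i := by
    intro j
    simp only [hF, mul_sub, Finset.sum_sub_distrib]
    congr 1
    rw [← sum_mul_sum_inv_mul hc (fun h ↦ ∑ k, m j k * D h k) l]
    refine Finset.sum_congr rfl fun i _ ↦ ?_
    congr 1
    refine Finset.sum_congr rfl fun h _ ↦ ?_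
    rw [Finset.mul_sum]
    exact Finset.sum_congr rfl fun k _ ↦ by rw [hm k j]; ring
  -- In `∇_j X_l - ∇_l X_j` the Christoffel terms cancel, leaving `∂_j X_l - ∂_l X_j` with `X_l =
  -- g_{kl} Xᵏ`.
  have hR : ∑ i, m l i * ∑ j, F j i * y j = ∑ j, ((∑ k, (dm j k l * X k + m k l * dX j k))
          - ∑ k, (dm l k j * X k + m k j * dX l k)) * y j := by
    simp only [Finset.mul_sum]
    rw [Finset.sum_comm]
    refine Finset.sum_congr rfl fun j _ ↦ ?_
    simp only [← mul_assoc]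
    rw [← Finset.sum_mul, hFm, hDm, hDm, ← Finset.sum_sub_distrib, ← Finset.sum_sub_distrib]
    congr 1
    refine Finset.sum_congr rfl fun k _ ↦ ?_
    rw [hm l k, hm j k, hdm j l k, hdm l j k, hdm k l j]
    ring
  have hA : ∑ i, m l i * ∑ j, ∑ k, Γ i j k * y j * y k
      = ∑ j, ∑ k, dm j k l * y j * y k - 1 / 2 * ∑ j, ∑ k, dm l j k * y j * y k := by
    have h1 : ∑ i, m l i * ∑ j, ∑ k, Γ i j k * y j * y k
        = ∑ j, ∑ k, 1 / 2 * (dm j l k + dm k l j - dm l j k) * (y j * y k) := by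
      simp only [Finset.mul_sum]
      rw [Finset.sum_comm]
      refine Finset.sum_congr rfl fun j _ ↦ ?_
      rw [Finset.sum_comm]
      refine Finset.sum_congr rfl fun k _ ↦ ?_
      rw [← hΓm, Finset.sum_mul]
      exact Finset.sum_congr rfl fun i _ ↦ by ring
    -- Two of the three metric derivatives agree after contraction with the symmetric `y j * y k`.
    have h2 : ∑ j, ∑ k, dm k l j * (y j * y k) = ∑ j, ∑ k, dm j k l * (y j * y k) := by
      rw [Finset.sum_comm]
      exact Finset.sum_congr rfl fun j _ ↦ Finset.sum_congr rfl fun k _ ↦ by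
        rw [hdm j l k]; ring
    have h3 : ∑ j, ∑ k, 1 / 2 * (dm j l k + dm k l j - dm l j k) * (y j * y k)
        = 1 / 2 * ∑ j, ∑ k, dm j k l * (y j * y k) + 1 / 2 * ∑ j, ∑ k, dm k l j * (y j * y k)
          - 1 / 2 * ∑ j, ∑ k, dm l j k * (y j * y k) := by
      simp only [Finset.mul_sum, ← Finset.sum_add_distrib, ← Finset.sum_sub_distrib]
      exact Finset.sum_congr rfl fun j _ ↦ Finset.sum_congr rfl fun k _ ↦ by
        rw [hdm j l k]; ring
    rw [h1, h3, h2]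
    simp only [← mul_assoc]
    ring
  rw [← hR, add_sub_assoc, ← hA, ← Finset.sum_add_distrib]
  exact Finset.sum_congr rfl fun i _ ↦ by rw [← mul_add, heq]

end Tensor

end GeomDyn

/-! ### The metric, the field and the energy in a chart. -/

namespace GeomDyn

variable {n : ℕ} {M : Type*} [TopologicalSpace M]
  [ChartedSpace (EuclideanSpace ℝ (Fin n)) M] [IsManifold (𝓡 n) ∞ M]

variable (g : SemiRiemannMetric n M) (X : (x : M) → TangentSpace (𝓡 n) x)
  {e : OpenPartialHomeomorph M (EuclideanSpace ℝ (Fin n))}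

omit [IsManifold (𝓡 n) ∞ M] in
theorem chartVec_add (p u v : EuclideanSpace ℝ (Fin n)) :
    chartVec e p (u + v) = chartVec e p u + chartVec e p v :=
  map_add (mfderiv (𝓡 n) (𝓡 n) e.symm p) u v

omit [IsManifold (𝓡 n) ∞ M] in
theorem chartVec_smul (p : EuclideanSpace ℝ (Fin n)) (r : ℝ) (v : EuclideanSpace ℝ (Fin n)) :
    chartVec e p (r • v) = r • chartVec e p v :=
  map_smul (mfderiv (𝓡 n) (𝓡 n) e.symm p) r v

variable (e) in
/-- The metric in the chart `e`, as a bilinear form on the model space. -/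
def chartForm (p : EuclideanSpace ℝ (Fin n)) :
    EuclideanSpace ℝ (Fin n) →L[ℝ] EuclideanSpace ℝ (Fin n) →L[ℝ] ℝ :=
  LinearMap.toContinuousLinearMap (LinearMap.toContinuousLinearMap.toLinearMap ∘ₗ
    LinearMap.mk₂ ℝ (fun u v ↦ g.inner (e.symm p) (chartVec e p u) (chartVec e p v))
      (fun _ _ _ ↦ by simp [chartVec_add]) (fun _ _ _ ↦ by simp [chartVec_smul])
      (fun _ _ _ ↦ by simp [chartVec_add]) (fun _ _ _ ↦ by simp [chartVec_smul]))

theorem chartForm_apply (p u v : EuclideanSpace ℝ (Fin n)) :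
    chartForm g e p u v = g.inner (e.symm p) (chartVec e p u) (chartVec e p v) := rfl

theorem chartForm_symm (p u v : EuclideanSpace ℝ (Fin n)) :
    chartForm g e p u v = chartForm g e p v u := g.symm _ _ _

omit [IsManifold (𝓡 n) ∞ M] in
theorem mdifferentiable_chart (he : e ∈ IsManifold.maximalAtlas (𝓡 n) ∞ M) :
    e.MDifferentiable (𝓡 n) (𝓡 n) :=
  ⟨(contMDiffOn_of_mem_maximalAtlas he).mdifferentiableOn (by simp),
    (contMDiffOn_symm_of_mem_maximalAtlas he).mdifferentiableOn (by simp)⟩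

omit [IsManifold (𝓡 n) ∞ M] in
theorem chartVec_fieldRep (he : e ∈ IsManifold.maximalAtlas (𝓡 n) ∞ M)
    {p : EuclideanSpace ℝ (Fin n)} (hp : p ∈ e.target) :
    chartVec e p (fieldRep X e p) = X (e.symm p) := by
  have h := (mdifferentiable_chart he).symm_comp_deriv (e.map_target hp)
  have h' := DFunLike.congr_fun h (X (e.symm p))
  rw [e.right_inv hp] at h'
  exact h'

omit [IsManifold (𝓡 n) ∞ M] in
theorem chartVec_surjective (he : e ∈ IsManifold.maximalAtlas (𝓡 n) ∞ M)
    {p : EuclideanSpace ℝ (Fin n)} (hp : p ∈ e.target) :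
    Function.Surjective (chartVec e p) :=
  (mdifferentiable_chart he).symm.mfderiv_surjective hp

omit [IsManifold (𝓡 n) ∞ M] in
theorem chartVec_injective (he : e ∈ IsManifold.maximalAtlas (𝓡 n) ∞ M)
    {p : EuclideanSpace ℝ (Fin n)} (hp : p ∈ e.target) :
    Function.Injective (chartVec e p) :=
  (mdifferentiable_chart he).symm.mfderiv_injective hp

/-- The tangent map of `e.symm` is smooth, and it is applied here to a constant section. -/
theorem contMDiffOn_chartVec (he : e ∈ IsManifold.maximalAtlas (𝓡 n) ∞ M)
    (v : EuclideanSpace ℝ (Fin n)) :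
    ContMDiffOn (𝓡 n) (𝓡 n).tangent ∞
      (fun p ↦ (⟨e.symm p, chartVec e p v⟩ : TangentBundle (𝓡 n) M)) e.target := by
  have h1 := (contMDiffOn_symm_of_mem_maximalAtlas he).contMDiffOn_tangentMapWithin
    (m := ∞) (by simp) e.open_target.uniqueMDiffOn
  have h2 : ContMDiffOn (𝓡 n) (𝓡 n).tangent ∞
      (fun p ↦ (⟨p, v⟩ : TangentBundle (𝓡 n) (EuclideanSpace ℝ (Fin n)))) e.target := by
    intro p hp
    exact contMDiffWithinAt_vectorSpace_iff_contDiffWithinAt.2 contDiffWithinAt_const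
  refine (h1.comp h2 fun p hp ↦ hp).congr fun p hp ↦ ?_
  simp only [tangentMapWithin, Function.comp, chartVec,
    mfderivWithin_of_isOpen e.open_target hp]

theorem contDiffOn_fieldRep (he : e ∈ IsManifold.maximalAtlas (𝓡 n) ∞ M)
    (hX : ContMDiff (𝓡 n) (𝓡 n).tangent ∞
      (fun x ↦ (⟨x, X x⟩ : TangentBundle (𝓡 n) M))) :
    ContDiffOn ℝ ∞ (fieldRep X e) e.target := by
  have h1 := (contMDiffOn_of_mem_maximalAtlas he).contMDiffOn_tangentMapWithin
    (m := ∞) (by simp) e.open_source.uniqueMDiffOn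
  have h2 := hX.comp_contMDiffOn (contMDiffOn_symm_of_mem_maximalAtlas he)
  have h3 := (contMDiff_snd_tangentBundle_modelSpace (EuclideanSpace ℝ (Fin n))
    (𝓡 n) (n := ∞)).comp_contMDiffOn (h1.comp h2 fun p hp ↦ e.map_target hp)
  refine (contMDiffOn_iff_contDiffOn.1 h3).congr fun p hp ↦ ?_
  simp only [tangentMapWithin, Function.comp, fieldRep,
    mfderivWithin_of_isOpen e.open_source (e.map_target hp)]
  rfl

/-- In finite dimension smoothness can be tested on fixed vectors `u`, `v`; there the smooth tensor
`g` is paired with two smooth fields. -/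
theorem contDiffOn_chartForm (he : e ∈ IsManifold.maximalAtlas (𝓡 n) ∞ M) :
    ContDiffOn ℝ ∞ (chartForm g e) e.target := by
  rw [contDiffOn_clm_apply]
  intro u
  rw [contDiffOn_clm_apply]
  intro v
  rw [← contMDiffOn_iff_contDiffOn]
  intro p hp
  have h := ContMDiffWithinAt.clm_bundle_apply₂ (F₁ := EuclideanSpace ℝ (Fin n))
    (F₂ := EuclideanSpace ℝ (Fin n)) (F₃ := ℝ) (E₃ := Bundle.Trivial M ℝ)
    (g.contMDiff.contMDiffAt.comp_contMDiffWithinAt p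
      (contMDiffOn_symm_of_mem_maximalAtlas he p hp))
    (contMDiffOn_chartVec he u p hp) (contMDiffOn_chartVec he v p hp)
  simp only [Bundle.contMDiffWithinAt_totalSpace] at h
  exact h.2

theorem metricMatrix_symm (p : EuclideanSpace ℝ (Fin n)) (i j : Fin n) :
    metricMatrix g e p i j = metricMatrix g e p j i := g.symm _ _ _

theorem chartForm_single (p : EuclideanSpace ℝ (Fin n)) (i j : Fin n) :
    chartForm g e p (EuclideanSpace.single i 1) (EuclideanSpace.single j 1)
      = metricMatrix g e p i j := rfl

theorem eq_sum_single (v : EuclideanSpace ℝ (Fin n)) :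
    v = ∑ i, v i • EuclideanSpace.single i (1 : ℝ) := by
  simpa using ((EuclideanSpace.basisFun (Fin n) ℝ).sum_repr v).symm

theorem chartForm_single_right (p v : EuclideanSpace ℝ (Fin n)) (l : Fin n) :
    chartForm g e p v (EuclideanSpace.single l 1) = ∑ i, metricMatrix g e p i l * v i := by
  conv_lhs => rw [eq_sum_single v]
  simp [chartForm_single, mul_comm]

/-- A vector in the left kernel would give a nonzero tangent vector orthogonal to all others. This
makes the matrix inverse in the definitions a genuine one. -/
theorem metricMatrix_mul_inv (he : e ∈ IsManifold.maximalAtlas (𝓡 n) ∞ M)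
    {p : EuclideanSpace ℝ (Fin n)} (hp : p ∈ e.target) :
    metricMatrix g e p * (metricMatrix g e p)⁻¹ = 1 := by
  refine Matrix.mul_nonsing_inv _ (isUnit_iff_ne_zero.2 fun h0 ↦ ?_)
  obtain ⟨v, hv, hv0⟩ := Matrix.exists_vecMul_eq_zero_iff.2 h0
  have h1 : ∀ l, chartForm g e p (WithLp.toLp 2 v) (EuclideanSpace.single l 1) = 0 := by
    intro l
    rw [chartForm_single_right]
    simpa [Matrix.vecMul, dotProduct, mul_comm] using congrFun hv0 l
  have h2 : ∀ u, chartForm g e p (WithLp.toLp 2 v) u = 0 := by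
    intro u
    rw [eq_sum_single u]
    simp [h1]
  have h3 : chartVec e p (WithLp.toLp 2 v) = 0 := by
    refine g.nondegenerate _ _ fun w ↦ ?_
    obtain ⟨u, rfl⟩ := chartVec_surjective he hp w
    exact h2 u
  have h4 : (WithLp.toLp 2 v : EuclideanSpace ℝ (Fin n)) = 0 :=
    chartVec_injective he hp (h3.trans (map_zero (mfderiv (𝓡 n) (𝓡 n) e.symm p)).symm)
  exact hv (by simpa using congrArg (WithLp.ofLp) h4)

/-- A function with values in `{-1, 0, 1}` near a point where it is continuous is constant
there. -/
theorem partialDeriv_eq_zero_of_eventually_mem {F : EuclideanSpace ℝ (Fin n) → ℝ}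
    {p : EuclideanSpace ℝ (Fin n)} (hF : ContinuousAt F p)
    (h : ∀ᶠ q in nhds p, F q ∈ ({-1, 0, 1} : Set ℝ)) (i : Fin n) : partialDeriv i F p = 0 := by
  have hconst : F =ᶠ[nhds p] fun _ ↦ F p := by
    have h1 : ∀ᶠ q in nhds p, |F q - F p| < 1 := by
      have := (Metric.continuousAt_iff'.1 hF) 1 one_pos
      simpa [Real.dist_eq] using this
    filter_upwards [h, h1] with q hq hd
    have hp := h.self_of_nhds
    simp only [Set.mem_insert_iff, Set.mem_singleton_iff] at hq hp
    -- Distinct values lie at distance at least `1`, so only the equal pairs survive.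
    rcases hq with hq | hq | hq <;> rcases hp with hp | hp | hp <;>
      rw [hq, hp] at hd ⊢ <;> norm_num at hd
  rw [partialDeriv, hconst.fderiv_eq]
  simp

theorem gradComp_energy_eq_zero (he : e ∈ IsManifold.maximalAtlas (𝓡 n) ∞ M)
    (hX : ContMDiff (𝓡 n) (𝓡 n).tangent ∞
      (fun x ↦ (⟨x, X x⟩ : TangentBundle (𝓡 n) M)))
    (hf : ∀ x ∈ (equilibria X)ᶜ, energy g X x ∈ ({-1, 0, 1} : Set ℝ))
    {p : EuclideanSpace ℝ (Fin n)} (hp : p ∈ e.target) (hpX : e.symm p ∈ (equilibria X)ᶜ)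
    (i : Fin n) : gradComp g (energy g X) e i p = 0 := by
  have htar := e.open_target.mem_nhds hp
  have hV := (contDiffOn_fieldRep X he hX).continuousOn.continuousAt htar
  have hB := (contDiffOn_chartForm g he).continuousOn.continuousAt htar
  -- Through the continuous representative, being a nonzero of `X` becomes an open condition near
  -- `p`.
  have hVX : ∀ q ∈ e.target, fieldRep X e q ≠ 0 ↔ e.symm q ∈ (equilibria X)ᶜ := by
    intro q hq
    rw [← (chartVec_injective he hq).ne_iff, chartVec_fieldRep X he hq]
    rw [show chartVec e q 0 = 0 from map_zero (mfderiv (𝓡 n) (𝓡 n) e.symm q)]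
    rfl
  have hcont : ContinuousAt (fun q ↦ energy g X (e.symm q)) p := by
    have h1 : ContinuousAt
        (fun q ↦ (1 / 2 : ℝ) * chartForm g e q (fieldRep X e q) (fieldRep X e q)) p :=
      continuousAt_const.mul ((hB.clm_apply hV).clm_apply hV)
    refine h1.congr ?_
    filter_upwards [htar] with q hq
    rw [chartForm_apply, chartVec_fieldRep X he hq]
    rfl
  have hmem : ∀ᶠ q in nhds p, energy g X (e.symm q) ∈ ({-1, 0, 1} : Set ℝ) := by
    filter_upwards [htar, hV.eventually_ne ((hVX p hp).2 hpX)] with q hq hq0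
    exact hf _ ((hVX q hq).1 hq0)
  simp [gradComp, partialDeriv_eq_zero_of_eventually_mem hcont hmem]

end GeomDyn

/-! ### The Lagrangian and the trajectory equation in a chart. -/

namespace GeomDyn

variable {n : ℕ} {M : Type*} [TopologicalSpace M]
  [ChartedSpace (EuclideanSpace ℝ (Fin n)) M] [IsManifold (𝓡 n) ∞ M]
  (g : SemiRiemannMetric n M) (X : (x : M) → TangentSpace (𝓡 n) x)
  {e : OpenPartialHomeomorph M (EuclideanSpace ℝ (Fin n))}

variable (e) in
/-- The one-form `g(X, ·)` in the chart `e`. -/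
def chartOneForm (p : EuclideanSpace ℝ (Fin n)) : EuclideanSpace ℝ (Fin n) →L[ℝ] ℝ :=
  chartForm g e p (fieldRep X e p)

theorem chartLagrangian_finslerJacobi (he : e ∈ IsManifold.maximalAtlas (𝓡 n) ∞ M) (k w : ℝ)
    {p : EuclideanSpace ℝ (Fin n)} (hp : p ∈ e.target) (v : EuclideanSpace ℝ (Fin n)) :
    chartLagrangian (finslerJacobi g X k w) e p v
      = w * √k * (√|chartForm g e p v v| * chartOneForm g X e p v) := by
  simp only [chartLagrangian, finslerJacobi, alpha, beta, chartOneForm, chartForm_apply,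
    chartVec_fieldRep X he hp]
  ring

/-- `q` is kept apart from `e.symm p` because `e.symm (e (γ t))` equals `γ t` only propositionally,
while tangent vectors depend on the point. -/
theorem chartForm_mfderiv (he : e ∈ IsManifold.maximalAtlas (𝓡 n) ∞ M)
    {p : EuclideanSpace ℝ (Fin n)} (hp : p ∈ e.target) {q : M} (hq : e.symm p = q)
    (u v : TangentSpace (𝓡 n) q) :
    chartForm g e p (mfderiv (𝓡 n) (𝓡 n) e q u) (mfderiv (𝓡 n) (𝓡 n) e q v)
      = g.inner q u v := by
  subst hq
  have h := (mdifferentiable_chart he).symm_comp_deriv (e.map_target hp)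
  rw [e.right_inv hp] at h
  have h' : ∀ u, chartVec e p (mfderiv (𝓡 n) (𝓡 n) e (e.symm p) u) = u :=
    fun u ↦ DFunLike.congr_fun h u
  exact congrArg₂ (fun a b ↦ g.inner (e.symm p) a b) (h' u) (h' v)

theorem chartOneForm_mfderiv (he : e ∈ IsManifold.maximalAtlas (𝓡 n) ∞ M)
    {p : EuclideanSpace ℝ (Fin n)} (hp : p ∈ e.target) {q : M} (hq : e.symm p = q)
    (v : TangentSpace (𝓡 n) q) :
    chartOneForm g X e p (mfderiv (𝓡 n) (𝓡 n) e q v) = g.inner q (X q) v := by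
  rw [← chartForm_mfderiv g he hp hq]
  subst hq
  rfl

omit [IsManifold (𝓡 n) ∞ M] in
theorem deriv_chartCurve (he : e ∈ IsManifold.maximalAtlas (𝓡 n) ∞ M) {γ : ℝ → M} {t : ℝ}
    (hγ : MDifferentiableAt 𝓘(ℝ, ℝ) (𝓡 n) γ t) (ht : γ t ∈ e.source) :
    deriv (chartCurve e γ) t = mfderiv (𝓡 n) (𝓡 n) e (γ t) (velocity γ t) := by
  have h := mfderiv_comp t ((mdifferentiable_chart he).mdifferentiableAt ht) hγ
  rw [← fderiv_apply_one_eq_deriv, ← mfderiv_eq_fderiv]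
  exact DFunLike.congr_fun h (1 : ℝ)

theorem differentiableAt_chartForm (he : e ∈ IsManifold.maximalAtlas (𝓡 n) ∞ M)
    {p : EuclideanSpace ℝ (Fin n)} (hp : p ∈ e.target) :
    DifferentiableAt ℝ (chartForm g e) p :=
  ((contDiffOn_chartForm g he).contDiffAt (e.open_target.mem_nhds hp)).differentiableAt (by simp)

theorem differentiableAt_fieldRep (he : e ∈ IsManifold.maximalAtlas (𝓡 n) ∞ M)
    (hX : ContMDiff (𝓡 n) (𝓡 n).tangent ∞
      (fun x ↦ (⟨x, X x⟩ : TangentBundle (𝓡 n) M)))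
    {p : EuclideanSpace ℝ (Fin n)} (hp : p ∈ e.target) :
    DifferentiableAt ℝ (fieldRep X e) p :=
  ((contDiffOn_fieldRep X he hX).contDiffAt (e.open_target.mem_nhds hp)).differentiableAt
    (by simp)

theorem hasFDerivAt_chartOneForm (he : e ∈ IsManifold.maximalAtlas (𝓡 n) ∞ M)
    (hX : ContMDiff (𝓡 n) (𝓡 n).tangent ∞
      (fun x ↦ (⟨x, X x⟩ : TangentBundle (𝓡 n) M)))
    {p : EuclideanSpace ℝ (Fin n)} (hp : p ∈ e.target) :
    HasFDerivAt (chartOneForm g X e)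
      ((chartForm g e p).comp (fderiv ℝ (fieldRep X e) p)
        + (fderiv ℝ (chartForm g e) p).flip (fieldRep X e p)) p :=
  (differentiableAt_chartForm g he hp).hasFDerivAt.clm_apply
    (differentiableAt_fieldRep X he hX hp).hasFDerivAt

theorem fderiv_chartForm_single (he : e ∈ IsManifold.maximalAtlas (𝓡 n) ∞ M)
    {p : EuclideanSpace ℝ (Fin n)} (hp : p ∈ e.target) (h i j : Fin n) :
    fderiv ℝ (chartForm g e) p (EuclideanSpace.single h 1) (EuclideanSpace.single i 1)
      (EuclideanSpace.single j 1) = partialDeriv h (fun q ↦ metricMatrix g e q i j) p := by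
  have h1 := (((differentiableAt_chartForm g he hp).hasFDerivAt.clm_apply
    (hasFDerivAt_const (EuclideanSpace.single i (1 : ℝ)) p)).clm_apply
    (hasFDerivAt_const (EuclideanSpace.single j (1 : ℝ)) p)).fderiv
  have h2 : partialDeriv h (fun q ↦ metricMatrix g e q i j) p
      = fderiv ℝ (fun q ↦ chartForm g e q (EuclideanSpace.single i 1)
        (EuclideanSpace.single j 1)) p (EuclideanSpace.single h 1) := rfl
  rw [h2, h1]
  simp

theorem fderiv_fieldRep_single (he : e ∈ IsManifold.maximalAtlas (𝓡 n) ∞ M)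
    (hX : ContMDiff (𝓡 n) (𝓡 n).tangent ∞
      (fun x ↦ (⟨x, X x⟩ : TangentBundle (𝓡 n) M)))
    {p : EuclideanSpace ℝ (Fin n)} (hp : p ∈ e.target) (j i : Fin n) :
    fderiv ℝ (fieldRep X e) p (EuclideanSpace.single j 1) i
      = partialDeriv j (fieldComp X e i) p := by
  have h1 := ((EuclideanSpace.proj (𝕜 := ℝ) i).hasFDerivAt.comp p
    (differentiableAt_fieldRep X he hX hp).hasFDerivAt).fderiv
  have h2 : fieldComp X e i = (EuclideanSpace.proj (𝕜 := ℝ) i) ∘ fieldRep X e := rfl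
  rw [partialDeriv, h2, h1]
  rfl

/-- The product rule for `∂_j (g_{kl} Xᵏ)`, in the form produced by `lowered_equation`. -/
theorem chartOneForm_deriv_single (he : e ∈ IsManifold.maximalAtlas (𝓡 n) ∞ M)
    (hX : ContMDiff (𝓡 n) (𝓡 n).tangent ∞
      (fun x ↦ (⟨x, X x⟩ : TangentBundle (𝓡 n) M)))
    {p : EuclideanSpace ℝ (Fin n)} (hp : p ∈ e.target) (j l : Fin n) :
    ((chartForm g e p).comp (fderiv ℝ (fieldRep X e) p)
        + (fderiv ℝ (chartForm g e) p).flip (fieldRep X e p)) (EuclideanSpace.single j 1)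
        (EuclideanSpace.single l 1)
      = ∑ k, (partialDeriv j (fun q ↦ metricMatrix g e q k l) p * fieldComp X e k p
        + metricMatrix g e p k l * partialDeriv j (fieldComp X e k) p) := by
  have h1 : fderiv ℝ (chartForm g e) p (EuclideanSpace.single j 1) (fieldRep X e p)
      (EuclideanSpace.single l 1)
      = ∑ k, partialDeriv j (fun q ↦ metricMatrix g e q k l) p * fieldComp X e k p := by
    conv_lhs => rw [eq_sum_single (fieldRep X e p)]
    simp [fderiv_chartForm_single g he hp, fieldComp, mul_comm]
  have h2 : chartForm g e p (fderiv ℝ (fieldRep X e) p (EuclideanSpace.single j 1))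
      (EuclideanSpace.single l 1)
      = ∑ k, metricMatrix g e p k l * partialDeriv j (fieldComp X e k) p := by
    rw [chartForm_single_right]
    exact Finset.sum_congr rfl fun k _ ↦ by rw [fderiv_fieldRep_single X he hX hp]
  rw [Finset.sum_add_distrib, ← h1, ← h2]
  exact add_comm _ _

theorem trilinear_apply_eq_sum (A : EuclideanSpace ℝ (Fin n) →L[ℝ]
    EuclideanSpace ℝ (Fin n) →L[ℝ] EuclideanSpace ℝ (Fin n) →L[ℝ] ℝ)
    (y v : EuclideanSpace ℝ (Fin n)) :
    A y y v = ∑ j, ∑ k,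
      A (EuclideanSpace.single j 1) (EuclideanSpace.single k 1) v * y j * y k := by
  conv_lhs => rw [eq_sum_single y]
  simp only [map_sum, map_smul, sum_apply, smul_apply,
    Finset.mul_sum, smul_eq_mul]
  rw [Finset.sum_comm]
  exact Finset.sum_congr rfl fun j _ ↦ Finset.sum_congr rfl fun k _ ↦ by ring

theorem trilinear_apply_eq_sum' (A : EuclideanSpace ℝ (Fin n) →L[ℝ]
    EuclideanSpace ℝ (Fin n) →L[ℝ] EuclideanSpace ℝ (Fin n) →L[ℝ] ℝ)
    (y v : EuclideanSpace ℝ (Fin n)) :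
    A v y y = ∑ j, ∑ k,
      A v (EuclideanSpace.single j 1) (EuclideanSpace.single k 1) * y j * y k := by
  conv_lhs => rw [eq_sum_single y]
  simp only [map_sum, map_smul, sum_apply, smul_apply,
    Finset.mul_sum, smul_eq_mul]
  rw [Finset.sum_comm]
  exact Finset.sum_congr rfl fun j _ ↦ Finset.sum_congr rfl fun k _ ↦ by ring

/-- The equation of the trajectories with the index lowered, where `f` is locally constant. -/
theorem IsTrajectory.lowered_equation {γ : ℝ → M} {I : Set ℝ} (hγ : IsTrajectory g X γ I)
    (he : e ∈ IsManifold.maximalAtlas (𝓡 n) ∞ M)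
    (hX : ContMDiff (𝓡 n) (𝓡 n).tangent ∞
      (fun x ↦ (⟨x, X x⟩ : TangentBundle (𝓡 n) M)))
    (hf : ∀ x ∈ (equilibria X)ᶜ, energy g X x ∈ ({-1, 0, 1} : Set ℝ))
    {t : ℝ} (ht : t ∈ I) (hte : γ t ∈ e.source) (htX : γ t ∈ (equilibria X)ᶜ)
    (v : EuclideanSpace ℝ (Fin n)) {x y a : EuclideanSpace ℝ (Fin n)}
    (hx : x = chartCurve e γ t) (hy : y = deriv (chartCurve e γ) t)
    (ha : a = deriv (deriv (chartCurve e γ)) t)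
    {W' : EuclideanSpace ℝ (Fin n) →L[ℝ] EuclideanSpace ℝ (Fin n) →L[ℝ] ℝ}
    (hW' : W' = (chartForm g e x).comp (fderiv ℝ (fieldRep X e) x)
        + (fderiv ℝ (chartForm g e) x).flip (fieldRep X e x)) :
    chartForm g e x a v + fderiv ℝ (chartForm g e) x y y v
        - 1 / 2 * fderiv ℝ (chartForm g e) x v y y
      = W' y v - W' v y := by
  have hp : x ∈ e.target := hx ▸ e.map_source hte
  have hW : ∀ j l, W' (EuclideanSpace.single j 1) (EuclideanSpace.single l 1)
      = ∑ k, (partialDeriv j (fun q ↦ metricMatrix g e q k l) x * fieldComp X e k x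
        + metricMatrix g e x k l * partialDeriv j (fieldComp X e k) x) := fun j l ↦ by
    rw [hW', chartOneForm_deriv_single g X he hX hp]
  have heq : ∀ i, a i + ∑ j, ∑ k, christoffel g e i j k x * y j * y k
      = ∑ j, helicity g X e j i x * y j := by
    intro i
    have h := hγ.equation e he t ht hte i
    rw [gradComp_energy_eq_zero g X he hX hf (hx ▸ hp)
      (by simpa only [chartCurve, e.left_inv hte] using htX), zero_add] at h
    rw [hx, hy, ha]
    exact h
  -- Both sides are linear in `v`, so basis vectors suffice, and there the index computation
  -- applies.
  have hsingle : ∀ l, chartForm g e x a (EuclideanSpace.single l 1)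
        + fderiv ℝ (chartForm g e) x y y (EuclideanSpace.single l 1)
        - 1 / 2 * fderiv ℝ (chartForm g e) x (EuclideanSpace.single l 1) y y
      = W' y (EuclideanSpace.single l 1) - W' (EuclideanSpace.single l 1) y := by
    intro l
    have h := GeomDyn.lowered_equation (metricMatrix_mul_inv g he hp) (metricMatrix_symm g x)
      (dm := fun h i j ↦ partialDeriv h (fun q ↦ metricMatrix g e q i j) x)
      (fun h i j ↦ by simp only [metricMatrix_symm g _ i j])
      (Γ := fun i j k ↦ christoffel g e i j k x) (fun _ _ _ ↦ rfl)
      (X := fun k ↦ fieldComp X e k x) (dX := fun j i ↦ partialDeriv j (fieldComp X e i) x)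
      (D := fun j i ↦ covDeriv g X e j i x) (fun _ _ ↦ rfl)
      (F := fun j i ↦ helicity g X e j i x) (fun _ _ ↦ rfl) (y := y) (a := a) heq l
    have h1 : W' y (EuclideanSpace.single l 1)
        = ∑ j, W' (EuclideanSpace.single j 1) (EuclideanSpace.single l 1) * y j := by
      conv_lhs => rw [eq_sum_single y]
      simp [mul_comm]
    have h2 : W' (EuclideanSpace.single l 1) y
        = ∑ j, W' (EuclideanSpace.single l 1) (EuclideanSpace.single j 1) * y j := by
      conv_lhs => rw [eq_sum_single y]
      simp [mul_comm]
    rw [h1, h2, ← Finset.sum_sub_distrib, chartForm_single_right, trilinear_apply_eq_sum,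
      trilinear_apply_eq_sum']
    simp only [fderiv_chartForm_single g he hp, ← sub_mul, hW]
    rw [← h]
    simp only [metricMatrix_symm g x l]
  rw [eq_sum_single v]
  simp only [map_sum, map_smul, sum_apply, smul_apply,
    Finset.mul_sum, smul_eq_mul, ← Finset.sum_add_distrib, ← Finset.sum_sub_distrib]
  exact Finset.sum_congr rfl fun l _ ↦ by linear_combination v l * hsingle l

end GeomDyn

/-! ### Trajectories are geodesics of `L`. -/

open GeomDyn in
theorem GeomDyn.IsTrajectory.isGeodesic {n : ℕ} {M : Type*} [TopologicalSpace M]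
    [ChartedSpace (EuclideanSpace ℝ (Fin n)) M] [IsManifold (𝓡 n) ∞ M]
    {g : SemiRiemannMetric n M} {X : (x : M) → TangentSpace (𝓡 n) x}
    (hX : ContMDiff (𝓡 n) (𝓡 n).tangent ∞
      (fun x ↦ (⟨x, X x⟩ : TangentBundle (𝓡 n) M)))
    (hf : ∀ x ∈ (equilibria X)ᶜ, energy g X x ∈ ({-1, 0, 1} : Set ℝ))
    (k w : ℝ) {γ : ℝ → M} {I : Set ℝ} (hγ : IsTrajectory g X γ I)
    (hγX : ∀ t ∈ I, γ t ∈ (equilibria X)ᶜ)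
    (h : ∀ t ∈ I, g.inner (γ t) (X (γ t)) (velocity γ t)
      = -g.inner (γ t) (velocity γ t) (velocity γ t)) :
    IsGeodesic (equilibria X)ᶜ (finslerJacobi g X k w) γ I := by
  have hd : ∀ t ∈ I, MDifferentiableAt 𝓘(ℝ, ℝ) (𝓡 n) γ t := fun t ht ↦
    ((hγ.smooth t ht).contMDiffAt (hγ.isOpen.mem_nhds ht)).mdifferentiableAt (by simp)
  have hβ : ∀ e ∈ IsManifold.maximalAtlas (𝓡 n) ∞ M, ∀ t ∈ I, γ t ∈ e.source →
      chartOneForm g X e (chartCurve e γ t) (deriv (chartCurve e γ) t)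
        = -chartForm g e (chartCurve e γ t) (deriv (chartCurve e γ) t)
          (deriv (chartCurve e γ) t) := by
    intro e he t ht hte
    have hp : chartCurve e γ t ∈ e.target := e.map_source hte
    have hq : e.symm (chartCurve e γ t) = γ t := e.left_inv hte
    rw [deriv_chartCurve he (hd t ht) hte, chartOneForm_mfderiv g X he hp hq,
      chartForm_mfderiv g he hp hq, h t ht]
  refine ⟨hγ.isOpen, hγ.ordConnected, hγX, hγ.smooth, fun e he t ht hte ↦ ?_,
    fun e he t ht hte ↦ ?_⟩
  · have hp : chartCurve e γ t ∈ e.target := e.map_source hte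
    refine (differentiableAt_lagrangian (w * √k) (differentiableAt_chartForm g he hp)
      (hasFDerivAt_chartOneForm g X he hX hp).differentiableAt
      (hβ e he t ht hte)).congr_of_eventuallyEq ?_
    filter_upwards [(e.open_target.preimage continuous_fst).mem_nhds
      (x := (chartCurve e γ t, deriv (chartCurve e γ) t)) hp] with z hz
    exact chartLagrangian_finslerJacobi g X he k w hz z.2
  -- The times spent in the chart; the coordinate expressions are valid only there.
  · set S : Set ℝ := I ∩ γ ⁻¹' e.source with hS_def
    have hS : IsOpen S := hγ.smooth.continuousOn.isOpen_inter_preimage hγ.isOpen e.open_source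
    have hp : ∀ s ∈ S, chartCurve e γ s ∈ e.target := fun s hs ↦ e.map_source hs.2
    have hx : ContDiffOn ℝ ∞ (chartCurve e γ) S :=
      contMDiffOn_iff_contDiffOn.1 ((contMDiffOn_of_mem_maximalAtlas he).comp
        (hγ.smooth.mono Set.inter_subset_left) fun s hs ↦ hs.2)
    have hy : ContDiffOn ℝ ∞ (deriv (chartCurve e γ)) S := hx.deriv_of_isOpen hS (by simp)
    have key := eulerLagrange_lagrangian (w * √k) hS
      (fun s hs ↦ ((hx.contDiffAt (hS.mem_nhds hs)).differentiableAt (by simp)).hasDerivAt)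
      (fun s hs ↦ ((hy.contDiffAt (hS.mem_nhds hs)).differentiableAt (by simp)).hasDerivAt)
      (fun s hs ↦ (differentiableAt_chartForm g he (hp s hs)).hasFDerivAt)
      (fun s hs ↦ hasFDerivAt_chartOneForm g X he hX (hp s hs))
      (fun s _ ↦ chartForm_symm g _)
      (fun s hs v ↦ hγ.lowered_equation g X he hX hf hs.1 hs.2 (hγX s hs.1) v rfl rfl rfl rfl)
      (fun s hs ↦ hβ e he s hs.1 hs.2) (t := t) ⟨ht, hte⟩
    refine (key.congr_of_eventuallyEq ?_).congr_deriv ?_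
    · filter_upwards [hS.mem_nhds ⟨ht, hte⟩] with s hs
      congr 1
      ext v
      exact chartLagrangian_finslerJacobi g X he k w (hp s hs) v
    · refine Filter.EventuallyEq.fderiv_eq ?_
      filter_upwards [e.open_target.mem_nhds (hp t ⟨ht, hte⟩)] with p hp
      exact (chartLagrangian_finslerJacobi g X he k w hp _).symm

theorem mainTheorem7 {n : ℕ} {M : Type*} [TopologicalSpace M]
    [ChartedSpace (EuclideanSpace ℝ (Fin n)) M] [IsManifold (𝓡 n) ∞ M]
    (g : SemiRiemannMetric n M) (X : (x : M) → TangentSpace (𝓡 n) x)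
    (hX : ContMDiff (𝓡 n) (𝓡 n).tangent ∞
      (fun x ↦ (⟨x, X x⟩ : TangentBundle (𝓡 n) M)))
    (hf : ∀ x ∈ (GeomDyn.equilibria X)ᶜ, GeomDyn.energy g X x ∈ ({-1, 0, 1} : Set ℝ))
    (k w : ℝ) (hk : 0 < k)
    (γ : ℝ → M) (I : Set ℝ) (hγ : GeomDyn.IsTrajectory g X γ I)
    (hγX : ∀ t ∈ I, γ t ∈ (GeomDyn.equilibria X)ᶜ)
    (hαβ : ∀ t ∈ I,
      g.inner (γ t) (GeomDyn.velocity γ t) (GeomDyn.velocity γ t) * √k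
        + GeomDyn.beta g X k (γ t) (GeomDyn.velocity γ t) = 0) :
    GeomDyn.IsPregeodesic (GeomDyn.equilibria X)ᶜ (GeomDyn.finslerJacobi g X k w) γ I := by
  have h : ∀ t ∈ I, g.inner (γ t) (X (γ t)) (GeomDyn.velocity γ t)
      = -g.inner (γ t) (GeomDyn.velocity γ t) (GeomDyn.velocity γ t) := by
    intro t ht
    have h1 := hαβ t ht
    rw [GeomDyn.beta] at h1
    refine mul_left_cancel₀ (Real.sqrt_pos.2 hk).ne' ?_
    linarith
  -- The change of parameter is the identity.
  exact ⟨hγ.smooth, I, id, hγ.isOpen, hγ.ordConnected, contDiffOn_id, by simp, by simp,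
    hγ.isGeodesic hX hf k w hγX h⟩

end
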